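/- For a unit vector $z\in\mathbb{C}^d$ let $P_z\in M_d(\mathbb{C})$ be the orthogonal projection onto $\mathbb{C}z$. A pure product state of $M_m\otimes M_n$ is a matrix $P_x\otimes P_y$ with unit vectors $x\in\mathbb{C}^m$, $y\in\mathbb{C}^n$. A density matrix is a positive semidefinite matrix of trace one. Let $T\in M_m\otimes M_n$ be a density matrix that is $B$-independent, i.e. $T=\sum_{\gamma=1}^p A_\gamma\otimes B_\gamma$ for some positive semidefinite $A_\gamma\in M_m$, $B_\gamma\in M_n$ such that the images of $B_1,\dots,B_p$ are independent subspaces of $\mathbb{C}^n$ (their sum is direct). Then $T$ has a decomposition $T=\sum_{\gamma=1}^p A_\gamma\otimes B_\gamma$, unique up to the order of the terms, such that $A_1,\dots,A_p$ are positive semidefinite, pairwise distinct and of trace one, and $B_1,\dots,B_p$ are positive semidefinite, nonzero and have independent images (the canonical decomposition of $T$). There is a unique decomposition of $T$ as a convex combination of pure product states if and only if every $A_\gamma$ and every $B_\gamma$ in the canonical decomposition has rank one. Here two convex combinations count as the same decomposition if each pure product state has the same total weight in both. Moreover, there is a unique decomposition of $T$ as a convex combination of pure product states if and only if $T$ can be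 written as a convex combination $$T=\sum_{\gamma=1}^p\lambda_\gamma\,P_{x_\gamma}\otimes P_{y_\gamma},\qquad \lambda_\gamma\ge 0,\quad \sum_{\gamma=1}^p\lambda_\gamma=1,$$ with unit vectors $y_1,\dots,y_p\in\mathbb{C}^n$ that are linearly independent and unit vectors $x_1,\dots,x_p\in\mathbb{C}^m$ such that $P_{x_1},\dots,P_{x_p}$ are distinct. -/

import Mathlib

open scoped Kronecker ComplexOrder

/-- A density matrix: positive semidefinite with trace one. -/
structure IsDensityMatrix {ι : Type*} [Fintype ι] (T : Matrix ι ι ℂ) : Prop where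
  posSemidef : T.PosSemidef
  trace_eq_one : T.trace = 1

/-- The image of a square matrix, as a subspace of `ℂⁿ`. -/
def matrixImage {n : ℕ} (B : Matrix (Fin n) (Fin n) ℂ) : Submodule ℂ (Fin n → ℂ) :=
  LinearMap.range B.mulVecLin

/-- For a unit vector `x`, the matrix `P_x = x x^*` of the orthogonal projection onto `ℂ x`. -/
def vecProj {n : ℕ} (x : EuclideanSpace ℂ (Fin n)) : Matrix (Fin n) (Fin n) ℂ :=
  Matrix.of fun i j => x i * star (x j)

/-- `vecProj x` really is the orthogonal projection onto the line spanned by a unit vector. -/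
theorem toEuclideanLin_vecProj {n : ℕ} (x : EuclideanSpace ℂ (Fin n)) (hx : ‖x‖ = 1)
    (v : EuclideanSpace ℂ (Fin n)) :
    Matrix.toEuclideanLin (vecProj x) v = (Submodule.span ℂ {x}).starProjection v := by
  rw [Submodule.starProjection_unit_singleton ℂ hx]
  ext i
  simp only [vecProj, Matrix.toLpLin_apply, Matrix.mulVec, dotProduct, Matrix.of_apply,
    PiLp.smul_apply, smul_eq_mul, PiLp.inner_apply, RCLike.inner_apply, Finset.sum_mul]
  refine Finset.sum_congr rfl fun j _ => ?_
  simp only [RCLike.star_def]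
  ring

/-- `T` is `B`-independent: `T = ∑ A_γ ⊗ B_γ` with `0 ≤ A_γ, B_γ` and the images of the `B_γ`
independent subspaces. -/
def IsBIndependent {m n : ℕ} (T : Matrix (Fin m × Fin n) (Fin m × Fin n) ℂ) : Prop :=
  ∃ (p : ℕ) (A : Fin p → Matrix (Fin m) (Fin m) ℂ) (B : Fin p → Matrix (Fin n) (Fin n) ℂ),
    (∀ γ, (A γ).PosSemidef) ∧ (∀ γ, (B γ).PosSemidef) ∧
    iSupIndep (fun γ => matrixImage (B γ)) ∧
    T = ∑ γ, A γ ⊗ₖ B γ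

/-- `T = ∑ A_γ ⊗ B_γ` is the canonical decomposition of `T`: the `A_γ` are positive, distinct and
of trace one, and the `B_γ` are positive, nonzero and have independent images.
(Without `B_γ ≠ 0` terms `A ⊗ 0` could be added at will.) -/
structure IsCanonicalDecomposition {m n p : ℕ} (T : Matrix (Fin m × Fin n) (Fin m × Fin n) ℂ)
    (A : Fin p → Matrix (Fin m) (Fin m) ℂ) (B : Fin p → Matrix (Fin n) (Fin n) ℂ) : Prop where
  posSemidef_left : ∀ γ, (A γ).PosSemidef
  trace_left : ∀ γ, (A γ).trace = 1
  distinct_left : Function.Injective A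
  posSemidef_right : ∀ γ, (B γ).PosSemidef
  ne_zero_right : ∀ γ, B γ ≠ 0
  independent_right : iSupIndep (fun γ => matrixImage (B γ))
  sum_eq : T = ∑ γ, A γ ⊗ₖ B γ

/-- A pure product state: `P_x ⊗ P_y` with unit vectors `x`, `y`. -/
def IsPureProductState {m n : ℕ} (P : Matrix (Fin m × Fin n) (Fin m × Fin n) ℂ) : Prop :=
  ∃ (x : EuclideanSpace ℂ (Fin m)) (y : EuclideanSpace ℂ (Fin n)),
    ‖x‖ = 1 ∧ ‖y‖ = 1 ∧ P = vecProj x ⊗ₖ vecProj y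

/-- A decomposition of `T` as a convex combination of pure product states. It is recorded as the
finitely supported function `w` that sends each state to its weight, so that neither the order of
the terms, nor terms of weight zero, nor splitting a term into several multiples of the same state
make a difference. -/
structure IsPureProductDecomposition {m n : ℕ} (T : Matrix (Fin m × Fin n) (Fin m × Fin n) ℂ)
    (w : Matrix (Fin m × Fin n) (Fin m × Fin n) ℂ →₀ ℝ) : Prop where
  pure : ∀ P ∈ w.support, IsPureProductState P
  nonneg : ∀ P, 0 ≤ w P
  sum_weights : (w.sum fun _ t => t) = 1
  sum_eq : T = w.sum fun P t => (t : ℂ) • P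

/-- `T` has exactly one decomposition as a convex combination of pure product states. -/
def HasUniquePureProductDecomposition {m n : ℕ}
    (T : Matrix (Fin m × Fin n) (Fin m × Fin n) ℂ) : Prop :=
  ∃! w : Matrix (Fin m × Fin n) (Fin m × Fin n) ℂ →₀ ℝ, IsPureProductDecomposition T w

/-! Independence of the images of the `B_γ` gives matrices `E_γ` with `E_γ B_δ = 0` for `δ ≠ γ` and
`E_γ B_γ = B_γ`. They isolate single terms of a decomposition, and comparing two canonical
decompositions through them makes the terms match one by one (`IsCanonicalDecomposition.exists_eq`).
Existence comes from normalising the `A_γ` and merging terms with equal `A_γ`.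

If some `A_γ` or `B_γ` has rank above one, it contains a sum `P_u + P_v` with `u`, `v` independent
(`P_z` here means `z z^*`, for any vector `z`). Such a sum is unchanged when `(u, v)` is replaced by
an orthogonal real combination, so infinitely many non-proportional vectors can be split off. Under
uniqueness each resulting product state would lie in one finite support, which is impossible
(`HasUniquePureProductDecomposition.exists_smul`).

If all ranks are one, then `T = ∑ l_γ P_{x_γ} ⊗ P_{y_γ}` with independent `y_γ` and distinct
`P_{x_γ}`. A nonnegative form that vanishes on `T` vanishes on every state of every decomposition.
Suitable product forms therefore show that only the states `P_{x_γ} ⊗ P_{y_γ}` can occur, and others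
read off their weights. -/

/-! ### Separating matrices for independent images -/

section Independence

/-- Independent images admit matrices acting as the identity on one of them and killing the
others. -/
theorem exists_mul_eq_ite_of_iSupIndep {n : ℕ} {ι : Type*} [DecidableEq ι]
    (B : ι → Matrix (Fin n) (Fin n) ℂ) (hB : iSupIndep fun i => matrixImage (B i)) :
    ∃ E : ι → Matrix (Fin n) (Fin n) ℂ, ∀ i j, E i * B j = if i = j then B i else 0 := by
  have key : ∀ i, ∃ E : Matrix (Fin n) (Fin n) ℂ, ∀ j, E * B j = if i = j then B i else 0 := by
    intro i
    let V := matrixImage (B i)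
    let W := ⨆ j, ⨆ _ : j ≠ i, matrixImage (B j)
    have hker : LinearMap.ker (W.mkQ ∘ₗ V.subtype) = ⊥ := by
      rw [LinearMap.ker_eq_bot']
      intro v hv
      have h1 : (v : Fin n → ℂ) ∈ W := by simpa using hv
      exact Subtype.ext (Submodule.disjoint_def.1 (hB i) v v.2 h1)
    -- `V` meets `W` trivially, so `V` embeds in the quotient by `W`. A left inverse `g` of this
    -- embedding gives a map that fixes `V` and kills `W`.
    obtain ⟨g, hg⟩ := LinearMap.exists_leftInverse_of_injective _ hker
    refine ⟨LinearMap.toMatrix' (V.subtype ∘ₗ g ∘ₗ W.mkQ), fun j => ?_⟩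
    apply Matrix.mulVec_injective
    funext v
    rw [← Matrix.mulVec_mulVec, LinearMap.toMatrix'_mulVec]
    have hmem : (B j).mulVec v ∈ matrixImage (B j) := ⟨v, rfl⟩
    split_ifs with h
    · subst h
      have := LinearMap.congr_fun hg ⟨(B i).mulVec v, hmem⟩
      exact congrArg Subtype.val this
    · have h0 : W.mkQ ((B j).mulVec v) = 0 := by
        have : (B j).mulVec v ∈ W :=
          (le_iSup₂_of_le (f := fun j (_ : j ≠ i) => matrixImage (B j)) j (Ne.symm h) le_rfl) hmem
        simpa using this
      simp [h0]
  choose E hE using key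
  exact ⟨E, hE⟩

theorem matrixImage_sum_le {n : ℕ} {ι : Type*} (s : Finset ι) (B : ι → Matrix (Fin n) (Fin n) ℂ) :
    matrixImage (∑ i ∈ s, B i) ≤ ⨆ i ∈ s, matrixImage (B i) := by
  rintro _ ⟨v, rfl⟩
  rw [Matrix.mulVecLin_apply, Matrix.sum_mulVec]
  refine Submodule.sum_mem _ fun i hi => ?_
  exact (le_iSup₂_of_le (f := fun i (_ : i ∈ s) => matrixImage (B i)) i hi le_rfl) ⟨v, rfl⟩

theorem matrixImage_smul_le {n : ℕ} (c : ℂ) (B : Matrix (Fin n) (Fin n) ℂ) :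
    matrixImage (c • B) ≤ matrixImage B := by
  rintro _ ⟨v, rfl⟩
  exact ⟨c • v, by simp⟩

end Independence

/-! ### Existence and uniqueness of the canonical decomposition -/

section Canonical

variable {m n p q : ℕ} {T : Matrix (Fin m × Fin n) (Fin m × Fin n) ℂ}

/-- Put `G i j = E i * B' j`, which also equals `B i * (F j)ᴴ` because `∑ B = ∑ B'`. Sandwiching the
block identity between `E i` and `(F j)ᴴ` gives `A i a b • G i j = A' j a b • G i j`, so `G i j ≠ 0`
forces `A i = A' j`. As the `A` and the `A'` are distinct, each row and each column of `G` has at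
most one nonzero entry. The row sums are `B i` and the column sums `B' j`, so a nonzero `G i j`
equals both. -/
theorem IsCanonicalDecomposition.exists_eq
    {A : Fin p → Matrix (Fin m) (Fin m) ℂ} {B : Fin p → Matrix (Fin n) (Fin n) ℂ}
    {A' : Fin q → Matrix (Fin m) (Fin m) ℂ} {B' : Fin q → Matrix (Fin n) (Fin n) ℂ}
    (h : IsCanonicalDecomposition T A B) (h' : IsCanonicalDecomposition T A' B') (i : Fin p) :
    ∃ j, A i = A' j ∧ B i = B' j := by
  obtain ⟨E, hE⟩ := exists_mul_eq_ite_of_iSupIndep B h.independent_right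
  obtain ⟨F, hF⟩ := exists_mul_eq_ite_of_iSupIndep B' h'.independent_right
  have hF' : ∀ i j, B' j * (F i).conjTranspose = if i = j then B' i else 0 := by
    intro i j
    have := congrArg Matrix.conjTranspose (hF i j)
    rw [Matrix.conjTranspose_mul, (h'.posSemidef_right j).1] at this
    rw [this]
    split_ifs
    · exact (h'.posSemidef_right i).1
    · simp
  have block : ∀ a b, ∑ k, A k a b • B k = ∑ k, A' k a b • B' k := by
    intro a b
    ext c d
    have := congrFun (congrFun (h.sum_eq.symm.trans h'.sum_eq) (a, c)) (b, d)
    simpa [Matrix.sum_apply] using this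
  -- Adding the diagonal blocks is the partial trace over the first factor; all `A k` and `A' k`
  -- have trace one.
  have hsum : ∑ k, B k = ∑ k, B' k := by
    have := Finset.sum_congr rfl fun a (_ : a ∈ Finset.univ) => block a a
    rw [Finset.sum_comm, Finset.sum_comm (s := Finset.univ (α := Fin m))] at this
    simp_rw [← Finset.sum_smul] at this
    have t1 : ∀ k, ∑ a, A k a a = 1 := h.trace_left
    have t2 : ∀ k, ∑ a, A' k a a = 1 := h'.trace_left
    simpa [t1, t2] using this
  have hEB : ∀ i, E i * ∑ k, B k = B i := by intro i; simp [Finset.mul_sum, hE]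
  have hBF : ∀ j, (∑ k, B' k) * (F j).conjTranspose = B' j := by
    intro j; simp [Finset.sum_mul, hF']
  have hG : ∀ i j, B i * (F j).conjTranspose = E i * B' j := by
    intro i j
    rw [← hEB i, hsum, Matrix.mul_assoc, hBF]
  have hA : ∀ i j, E i * B' j ≠ 0 → A i = A' j := by
    intro i j hne
    ext a b
    have := congrArg (fun X => E i * X * (F j).conjTranspose) (block a b)
    simp only [Finset.mul_sum, Finset.sum_mul, Matrix.mul_smul, hE, smul_ite, smul_zero,
      Finset.sum_ite_eq, Finset.mem_univ, if_true, Matrix.smul_mul, Matrix.mul_assoc, hF', hG,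
      mul_ite, mul_zero] at this
    exact smul_left_injective ℂ hne (by simpa [Matrix.mul_assoc, hF', hG] using this)
  have hBi : ∑ j, E i * B' j = B i := by rw [← Finset.mul_sum, ← hsum, hEB]
  obtain ⟨j, hj⟩ : ∃ j, E i * B' j ≠ 0 := by
    by_contra! hall
    exact h.ne_zero_right i (by rw [← hBi]; simp [hall])
  refine ⟨j, hA i j hj, ?_⟩
  have e1 : B i = E i * B' j := by
    rw [← hBi]
    refine Finset.sum_eq_single j (fun k _ hk => ?_) (by simp)
    by_contra hne
    exact hk (h'.distinct_left ((hA i k hne).symm.trans (hA i j hj)))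
  have e2 : B' j = E i * B' j := by
    have : ∑ k, B k * (F j).conjTranspose = B' j := by rw [← Finset.sum_mul, hsum, hBF]
    rw [← hG]
    nth_rewrite 1 [← this]
    refine Finset.sum_eq_single i (fun k _ hk => ?_) (by simp)
    by_contra hne
    exact hk (h.distinct_left ((hA k j (by rwa [← hG])).trans (hA i j hj).symm))
  exact e1.trans e2.symm

theorem IsCanonicalDecomposition.exists_equiv
    {A : Fin p → Matrix (Fin m) (Fin m) ℂ} {B : Fin p → Matrix (Fin n) (Fin n) ℂ}
    {A' : Fin q → Matrix (Fin m) (Fin m) ℂ} {B' : Fin q → Matrix (Fin n) (Fin n) ℂ}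
    (h : IsCanonicalDecomposition T A B) (h' : IsCanonicalDecomposition T A' B') :
    ∃ σ : Fin q ≃ Fin p, ∀ γ, A' γ = A (σ γ) ∧ B' γ = B (σ γ) := by
  choose f hf using fun γ => h'.exists_eq h γ
  have hbij : Function.Bijective f := by
    refine ⟨fun a b hab => h'.distinct_left ?_, fun i => ?_⟩
    · rw [(hf a).1, (hf b).1, hab]
    · obtain ⟨j, hj, -⟩ := h.exists_eq h' i
      exact ⟨j, h.distinct_left ((hf j).1.symm.trans hj.symm)⟩
  exact ⟨Equiv.ofBijective f hbij, hf⟩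

/-- Zero terms are dropped, the trace of `A γ` is moved into `B γ`, and terms with the same
normalised `A γ` are merged by adding their right factors. Merging keeps independence because the
merged images lie in suprema over disjoint sets of indices. -/
theorem IsBIndependent.exists_isCanonicalDecomposition (hB : IsBIndependent T) :
    ∃ (p : ℕ) (A : Fin p → Matrix (Fin m) (Fin m) ℂ) (B : Fin p → Matrix (Fin n) (Fin n) ℂ),
      IsCanonicalDecomposition T A B := by
  classical
  obtain ⟨p, A, B, hA, hB, hind, rfl⟩ := hB
  let N : Fin p → Matrix (Fin m) (Fin m) ℂ := fun γ => (A γ).trace⁻¹ • A γ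
  let C : Fin p → Matrix (Fin n) (Fin n) ℂ := fun γ => (A γ).trace • B γ
  let I : Finset (Fin p) := {γ | A γ ≠ 0 ∧ B γ ≠ 0}
  have htr : ∀ γ ∈ I, (A γ).trace ≠ 0 := fun γ hγ h =>
    (Finset.mem_filter.1 hγ).2.1 ((hA γ).trace_eq_zero_iff.1 h)
  have hC : ∀ γ, (C γ).PosSemidef := fun γ => (hB γ).smul (hA γ).trace_nonneg
  have hC0 : ∀ γ ∈ I, C γ ≠ 0 := fun γ hγ =>
    smul_ne_zero (htr γ hγ) (Finset.mem_filter.1 hγ).2.2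
  let S := I.image N
  let fib : Matrix (Fin m) (Fin m) ℂ → Finset (Fin p) := fun s => {γ ∈ I | N γ = s}
  let e := S.equivFin.symm
  have hS : ∀ k, ∃ γ ∈ I, N γ = (e k : Matrix (Fin m) (Fin m) ℂ) := fun k =>
    Finset.mem_image.1 (e k).2
  have hle : ∀ k, matrixImage (∑ γ ∈ fib (e k), C γ) ≤
      ⨆ γ ∈ {γ | N γ = (e k : Matrix (Fin m) (Fin m) ℂ)}, matrixImage (B γ) := fun k =>
    (matrixImage_sum_le _ _).trans <| iSup₂_le fun γ hγ =>
      (matrixImage_smul_le _ _).trans <|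
        le_iSup₂_of_le (f := fun γ (_ : γ ∈ {γ | N γ = (e k : Matrix (Fin m) (Fin m) ℂ)}) =>
          matrixImage (B γ)) γ (Finset.mem_filter.1 hγ).2 le_rfl
  refine ⟨S.card, fun k => e k, fun k => ∑ γ ∈ fib (e k), C γ, ?_, ?_, ?_, ?_, ?_, ?_, ?_⟩
  · intro k
    obtain ⟨γ, hγ, h⟩ := hS k
    rw [← h]
    exact (hA γ).smul (inv_nonneg.2 (hA γ).trace_nonneg)
  · intro k
    obtain ⟨γ, hγ, h⟩ := hS k
    rw [← h, Matrix.trace_smul, smul_eq_mul, inv_mul_cancel₀ (htr γ hγ)]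
  · exact Subtype.val_injective.comp e.injective
  · exact fun k => Matrix.posSemidef_sum _ fun γ _ => hC γ
  · intro k h0
    obtain ⟨γ, hγ, h⟩ := hS k
    -- Positive matrices cannot cancel: if the sum is zero, all the nonnegative traces are zero, and
    -- so are the summands.
    have h1 := congrArg Matrix.trace h0
    rw [Matrix.trace_sum, Matrix.trace_zero,
      Finset.sum_eq_zero_iff_of_nonneg fun γ _ => (hC γ).trace_nonneg] at h1
    exact hC0 γ hγ ((hC γ).trace_eq_zero_iff.1 (h1 γ (Finset.mem_filter.2 ⟨hγ, h⟩)))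
  · intro k
    refine (hind.disjoint_biSup_biSup' (s := {γ | N γ = (e k : Matrix (Fin m) (Fin m) ℂ)})
      (t := {γ | N γ ≠ (e k : Matrix (Fin m) (Fin m) ℂ)})
      (Set.disjoint_left.2 fun γ h1 h2 => h2 h1) (Set.toFinite _)).mono (hle k) ?_
    refine iSup₂_le fun l hl => (hle l).trans ?_
    refine biSup_mono fun γ (hγ : N γ = _) => ?_
    intro (h : N γ = _)
    exact hl (e.injective (Subtype.ext (hγ.symm.trans h)))
  · have h1 : ∑ γ, A γ ⊗ₖ B γ = ∑ γ ∈ I, N γ ⊗ₖ C γ := by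
      rw [Finset.sum_filter]
      refine Finset.sum_congr rfl fun γ _ => ?_
      split_ifs with h
      · have := htr γ (Finset.mem_filter.2 ⟨Finset.mem_univ _, h⟩)
        simp [N, C, Matrix.smul_kronecker, Matrix.kronecker_smul, smul_smul, this]
      · rcases not_and_or.1 h with h | h <;> simp [not_not.1 h]
    rw [h1, ← Finset.sum_fiberwise_of_maps_to (t := S)
      (fun γ hγ => Finset.mem_image_of_mem N hγ), ← Finset.sum_coe_sort S, ← e.sum_comp]
    refine Finset.sum_congr rfl fun k _ => ?_
    ext ⟨a, b⟩ ⟨c, d⟩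
    simp only [Matrix.sum_apply, Matrix.kronecker_apply, Finset.mul_sum]
    refine Finset.sum_congr rfl fun γ hγ => ?_
    rw [(Finset.mem_filter.1 hγ).2]

end Canonical

/-! ### Matrices `x x^*` and their Kronecker products -/

section VecProj

variable {m n : ℕ}

theorem vecProj_eq_vecMulVec (x : EuclideanSpace ℂ (Fin n)) :
    vecProj x = Matrix.vecMulVec x.ofLp (star x.ofLp) := rfl

theorem vecProj_smul (c : ℂ) (x : EuclideanSpace ℂ (Fin n)) :
    vecProj (c • x) = Complex.normSq c • vecProj x := by
  ext i j
  simp only [vecProj, Matrix.of_apply, PiLp.smul_apply, smul_eq_mul, Matrix.smul_apply,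
    Complex.real_smul, ← Complex.mul_conj, star_mul', RCLike.star_def]
  ring

theorem trace_vecProj (x : EuclideanSpace ℂ (Fin n)) :
    (vecProj x).trace = ((‖x‖ ^ 2 : ℝ) : ℂ) := by
  rw [EuclideanSpace.norm_sq_eq]
  push_cast
  exact Finset.sum_congr rfl fun i _ => Complex.mul_conj' (x i)

theorem vecProj_eq_of_eq_smul {x x' : EuclideanSpace ℂ (Fin n)} (hx : ‖x‖ = 1) (hx' : ‖x'‖ = 1)
    {c : ℂ} (h : x = c • x') : vecProj x = vecProj x' := by
  have hc : ‖c‖ = 1 := by rw [h, norm_smul, hx', mul_one] at hx; exact hx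
  rw [h, vecProj_smul, Complex.normSq_eq_norm_sq, hc]
  simp

theorem posSemidef_vecProj (x : EuclideanSpace ℂ (Fin n)) : (vecProj x).PosSemidef :=
  Matrix.posSemidef_vecMulVec_self_star _

theorem vecProj_ne_zero {x : EuclideanSpace ℂ (Fin n)} (hx : x ≠ 0) : vecProj x ≠ 0 := by
  intro h
  have := trace_vecProj x
  rw [h, Matrix.trace_zero] at this
  exact hx (by simpa using this.symm)

theorem rank_vecProj {x : EuclideanSpace ℂ (Fin n)} (hx : x ≠ 0) : (vecProj x).rank = 1 := by
  refine le_antisymm (Matrix.rank_vecMulVec_le _ _) (Nat.one_le_iff_ne_zero.2 fun h => ?_)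
  refine vecProj_ne_zero hx ?_
  rw [Matrix.rank, Submodule.finrank_eq_zero, LinearMap.range_eq_bot] at h
  exact Matrix.mulVec_injective (funext fun v => by simpa using LinearMap.congr_fun h v)

theorem IsPureProductState.trace_eq_one {P : Matrix (Fin m × Fin n) (Fin m × Fin n) ℂ}
    (hP : IsPureProductState P) : P.trace = 1 := by
  obtain ⟨x, y, hx, hy, rfl⟩ := hP
  simp [Matrix.trace_kronecker, trace_vecProj, hx, hy]

/-- Up to a scalar, a nonzero vector is determined by its product with another one. -/
theorem exists_smul_of_kronecker_eq_smul {x x' : EuclideanSpace ℂ (Fin m)}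
    {y y' : EuclideanSpace ℂ (Fin n)} (hx : x ≠ 0) (hy : y ≠ 0) {r : ℂ}
    (h : vecProj x ⊗ₖ vecProj y = r • (vecProj x' ⊗ₖ vecProj y')) :
    (∃ c : ℂ, x = c • x') ∧ ∃ c : ℂ, y = c • y' := by
  obtain ⟨i, hi⟩ : ∃ i, x i ≠ 0 := by
    by_contra! h0; exact hx (by ext i; simpa using h0 i)
  obtain ⟨j, hj⟩ : ∃ j, y j ≠ 0 := by
    by_contra! h0; exact hy (by ext i; simpa using h0 i)
  -- Only column `(i, j)` is needed: `b = j` isolates `x`, and `a = i` isolates `y`.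
  have hent : ∀ a b, x a * star (x i) * (y b * star (y j)) =
      r * (x' a * star (x' i) * (y' b * star (y' j))) := fun a b =>
    congrFun (congrFun h (a, b)) (i, j)
  have hi' : star (x i) ≠ 0 := star_ne_zero.2 hi
  have hj' : star (y j) ≠ 0 := star_ne_zero.2 hj
  constructor
  · refine ⟨r * star (x' i) * (y' j * star (y' j)) / (star (x i) * (y j * star (y j))), ?_⟩
    ext a
    rw [PiLp.smul_apply, smul_eq_mul, div_mul_eq_mul_div, eq_div_iff (by simp [hi, hj])]
    linear_combination hent a j
  · refine ⟨r * star (y' j) * (x' i * star (x' i)) / (star (y j) * (x i * star (x i))), ?_⟩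
    ext b
    rw [PiLp.smul_apply, smul_eq_mul, div_mul_eq_mul_div, eq_div_iff (by simp [hi, hj])]
    linear_combination hent i b

end VecProj

/-! ### Uniqueness for independent `y_γ` and distinct `P_{x_γ}` -/

section Decomposition

variable {m n : ℕ} {T : Matrix (Fin m × Fin n) (Fin m × Fin n) ℂ}

theorem sum_smul_eq_linearCombination (w : Matrix (Fin m × Fin n) (Fin m × Fin n) ℂ →₀ ℝ) :
    (w.sum fun P t => (t : ℂ) • P) = Finsupp.linearCombination ℝ id w := by
  rw [Finsupp.linearCombination_apply]
  rfl

/-- Pure product states have trace one, so the total weight is the trace of `T`. -/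
theorem isPureProductDecomposition_of_trace_eq_one (hT : T.trace = 1)
    {w : Matrix (Fin m × Fin n) (Fin m × Fin n) ℂ →₀ ℝ}
    (hw : ∀ P ∈ w.support, IsPureProductState P) (h0 : 0 ≤ w)
    (hs : T = Finsupp.linearCombination ℝ id w) : IsPureProductDecomposition T w where
  pure := hw
  nonneg := h0
  sum_weights := by
    rw [hs, ← sum_smul_eq_linearCombination, Finsupp.sum, Matrix.trace_sum] at hT
    rw [Finsupp.sum, ← Complex.ofReal_inj, Complex.ofReal_one, ← hT, Complex.ofReal_sum]
    refine Finset.sum_congr rfl fun P hP => ?_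
    rw [Matrix.trace_smul, (hw P hP).trace_eq_one, smul_eq_mul, mul_one]
  sum_eq := by rw [sum_smul_eq_linearCombination, hs]

/-- The value of the quadratic form of a matrix at the product vector `star (a ⊗ b)`. -/
noncomputable def productForm (a : Fin m → ℂ) (b : Fin n → ℂ) :
    Matrix (Fin m × Fin n) (Fin m × Fin n) ℂ →ₗ[ℝ] ℝ where
  toFun M := (∑ s, ∑ t, a s.1 * b s.2 * M s t * (star (a t.1) * star (b t.2))).re
  map_add' M N := by
    simp only [Matrix.add_apply, mul_add, add_mul, Finset.sum_add_distrib, Complex.add_re]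
  map_smul' r M := by
    rw [RingHom.id_apply, smul_eq_mul, ← Complex.re_ofReal_mul, Finset.mul_sum]
    simp only [Finset.mul_sum, Matrix.smul_apply, Complex.real_smul]
    refine congrArg Complex.re (Finset.sum_congr rfl fun s _ => Finset.sum_congr rfl fun t _ => ?_)
    ring

theorem productForm_vecProj (a : Fin m → ℂ) (b : Fin n → ℂ) (x : EuclideanSpace ℂ (Fin m))
    (y : EuclideanSpace ℂ (Fin n)) :
    productForm a b (vecProj x ⊗ₖ vecProj y) =
      Complex.normSq (a ⬝ᵥ x.ofLp) * Complex.normSq (b ⬝ᵥ y.ofLp) := by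
  rw [← Complex.ofReal_re (_ * _)]
  refine congrArg Complex.re ?_
  have h : (a ⬝ᵥ x.ofLp) * (b ⬝ᵥ y.ofLp) =
      ∑ s : Fin m × Fin n, (a s.1 * x s.1) * (b s.2 * y s.2) := by
    rw [Fintype.sum_prod_type, dotProduct, dotProduct, Finset.sum_mul_sum]
  rw [← Complex.normSq_mul, ← Complex.mul_conj, h, map_sum, Finset.sum_mul_sum]
  refine Finset.sum_congr rfl fun s _ => Finset.sum_congr rfl fun t _ => ?_
  simp only [vecProj, Matrix.kroneckerMap_apply, Matrix.of_apply, RCLike.star_def, map_mul]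
  ring

theorem IsPureProductState.productForm_nonneg {P : Matrix (Fin m × Fin n) (Fin m × Fin n) ℂ}
    (hP : IsPureProductState P) (a : Fin m → ℂ) (b : Fin n → ℂ) : 0 ≤ productForm a b P := by
  obtain ⟨x, y, -, -, rfl⟩ := hP
  rw [productForm_vecProj]
  exact mul_nonneg (Complex.normSq_nonneg _) (Complex.normSq_nonneg _)

theorem IsPureProductDecomposition.productForm_eq
    {w : Matrix (Fin m × Fin n) (Fin m × Fin n) ℂ →₀ ℝ} (hw : IsPureProductDecomposition T w)
    (a : Fin m → ℂ) (b : Fin n → ℂ) :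
    productForm a b T = ∑ P ∈ w.support, w P * productForm a b P := by
  rw [hw.sum_eq, sum_smul_eq_linearCombination, Finsupp.linearCombination_apply, Finsupp.sum,
    map_sum]
  simp

/-- A vanishing sum of nonnegative terms has only zero terms, and weights on the support are
nonzero. -/
theorem IsPureProductDecomposition.productForm_eq_zero
    {w : Matrix (Fin m × Fin n) (Fin m × Fin n) ℂ →₀ ℝ} (hw : IsPureProductDecomposition T w)
    {a : Fin m → ℂ} {b : Fin n → ℂ} (h : productForm a b T = 0)
    {P : Matrix (Fin m × Fin n) (Fin m × Fin n) ℂ} (hP : P ∈ w.support) :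
    productForm a b P = 0 := by
  rw [hw.productForm_eq, Finset.sum_eq_zero_iff_of_nonneg fun Q hQ =>
    mul_nonneg (hw.nonneg Q) ((hw.pure Q hQ).productForm_nonneg a b)] at h
  exact (mul_eq_zero.1 (h P hP)).resolve_left (Finsupp.mem_support_iff.1 hP)

theorem LinearIndependent.exists_dotProduct_eq_ite {p : ℕ} {y : Fin p → EuclideanSpace ℂ (Fin n)}
    (hy : LinearIndependent ℂ y) :
    ∃ F : Fin p → Fin n → ℂ, ∀ i j, F i ⬝ᵥ (y j).ofLp = if i = j then 1 else 0 := by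
  obtain ⟨g, hg⟩ := LinearMap.exists_leftInverse_of_injective _
    (LinearMap.ker_eq_bot.2 hy.fintypeLinearCombination_injective)
  refine ⟨LinearMap.toMatrix' (g ∘ₗ (WithLp.linearEquiv 2 ℂ (Fin n → ℂ)).symm.toLinearMap),
    fun i j => ?_⟩
  have h1 := congrFun (LinearMap.toMatrix'_mulVec
    (g ∘ₗ (WithLp.linearEquiv 2 ℂ (Fin n → ℂ)).symm.toLinearMap) (y j).ofLp) i
  have h2 := congrFun (LinearMap.congr_fun hg (Pi.single j 1)) i
  rw [Matrix.mulVec] at h1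
  rw [h1]
  simpa [Fintype.linearCombination_apply_single, Pi.single_apply] using h2

variable {p : ℕ} {l : Fin p → ℝ} {x : Fin p → EuclideanSpace ℂ (Fin m)}
  {y : Fin p → EuclideanSpace ℂ (Fin n)}

/-- A product functional `a ⊗ b` that kills every `x γ ⊗ y γ` has form value zero on `T`, hence
kills `u ⊗ v` (this is `test`). Functionals `b` killing all `y γ` put `v` in their span. Pairing `F
γ` with a vector orthogonal to `x γ` makes `u` proportional to `x γ` whenever `v` has a nonzero `y
γ` coordinate. Distinctness of the `P_{x_γ}` leaves just one such coordinate. -/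
theorem IsPureProductDecomposition.exists_eq_of_mem_support
    (hx : ∀ γ, ‖x γ‖ = 1) (hy : ∀ γ, ‖y γ‖ = 1) (hli : LinearIndependent ℂ y)
    (hinj : Function.Injective fun γ => vecProj (x γ))
    (hT : T = ∑ γ, l γ • (vecProj (x γ) ⊗ₖ vecProj (y γ)))
    {w : Matrix (Fin m × Fin n) (Fin m × Fin n) ℂ →₀ ℝ} (hw : IsPureProductDecomposition T w)
    {P : Matrix (Fin m × Fin n) (Fin m × Fin n) ℂ} (hP : P ∈ w.support) :
    ∃ γ, P = vecProj (x γ) ⊗ₖ vecProj (y γ) := by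
  obtain ⟨u, v, hu, hv, rfl⟩ := hw.pure P hP
  obtain ⟨F, hF⟩ := hli.exists_dotProduct_eq_ite
  have test : ∀ a b, (∀ γ, a ⬝ᵥ (x γ).ofLp = 0 ∨ b ⬝ᵥ (y γ).ofLp = 0) →
      a ⬝ᵥ u.ofLp = 0 ∨ b ⬝ᵥ v.ofLp = 0 := by
    intro a b hab
    have h0 : productForm a b T = 0 := by
      rw [hT, map_sum]
      refine Finset.sum_eq_zero fun γ _ => ?_
      rw [map_smul, productForm_vecProj]
      rcases hab γ with h | h <;> simp [h]
    have := hw.productForm_eq_zero h0 hP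
    rwa [productForm_vecProj, mul_eq_zero, Complex.normSq_eq_zero, Complex.normSq_eq_zero] at this
  have hdot : ∀ s t : EuclideanSpace ℂ (Fin m), star s.ofLp ⬝ᵥ t.ofLp = inner ℂ s t := by
    intro s t
    rw [EuclideanSpace.inner_eq_star_dotProduct, dotProduct_comm]
  have hvsum : v = ∑ γ, (F γ ⬝ᵥ v.ofLp) • y γ := by
    ext c
    -- This `b` reads the `c`-th coordinate of `v - ∑ (F γ ⬝ᵥ v) • y γ`, and it kills every `y γ`.
    have := test (star u.ofLp) (Pi.single c 1 - ∑ γ, y γ c • F γ) fun γ => Or.inr (by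
      simp [sub_dotProduct, sum_dotProduct, hF])
    rw [hdot, inner_self_eq_norm_sq_to_K, hu] at this
    simp only [RCLike.ofReal_one, one_pow, one_ne_zero, false_or, sub_dotProduct, sum_dotProduct,
      single_dotProduct, one_mul, smul_dotProduct, smul_eq_mul, sub_eq_zero] at this
    rw [this]
    simp [mul_comm]
  have hux : ∀ γ, F γ ⬝ᵥ v.ofLp ≠ 0 → vecProj u = vecProj (x γ) := by
    intro γ hγ
    -- The component of `u` orthogonal to `x γ`; the test shows that it is orthogonal to `u` too,
    -- hence zero.
    let s := u - inner ℂ (x γ) u • x γ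
    have hs : inner ℂ s (x γ) = 0 := by
      simp [s, hx]
    have := (test (star s.ofLp) (F γ) fun δ => by
      by_cases h : γ = δ
      · subst h; exact Or.inl (by rw [hdot, hs])
      · exact Or.inr (by rw [hF, if_neg h])).resolve_right hγ
    rw [hdot] at this
    have hss : inner ℂ s s = 0 := by
      change inner ℂ s (u - inner ℂ (x γ) u • x γ) = 0
      rw [inner_sub_right, inner_smul_right, hs, this]; simp
    exact vecProj_eq_of_eq_smul hu (hx γ) (sub_eq_zero.1 (inner_self_eq_zero.1 hss))
  obtain ⟨γ, hγ⟩ : ∃ γ, F γ ⬝ᵥ v.ofLp ≠ 0 := by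
    by_contra! h
    rw [hvsum] at hv
    simp [h] at hv
  have hvγ : v = (F γ ⬝ᵥ v.ofLp) • y γ := by
    refine hvsum.trans (Finset.sum_eq_single γ (fun δ _ hδ => ?_) (by simp))
    by_cases h : F δ ⬝ᵥ v.ofLp = 0
    · rw [h, zero_smul]
    · exact absurd (hinj ((hux δ h).symm.trans (hux γ hγ))) hδ
  exact ⟨γ, by rw [hux γ hγ, vecProj_eq_of_eq_smul hv (hy γ) hvγ]⟩

/-- The form at `star (x γ)` and `F γ` is one on the state of index `γ` and zero on the others, so
its value on `T` is the weight in any decomposition. -/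
theorem IsPureProductDecomposition.apply_eq
    (hx : ∀ γ, ‖x γ‖ = 1) (hy : ∀ γ, ‖y γ‖ = 1) (hli : LinearIndependent ℂ y)
    (hinj : Function.Injective fun γ => vecProj (x γ))
    (hT : T = ∑ γ, l γ • (vecProj (x γ) ⊗ₖ vecProj (y γ)))
    {w : Matrix (Fin m × Fin n) (Fin m × Fin n) ℂ →₀ ℝ} (hw : IsPureProductDecomposition T w)
    (γ : Fin p) : w (vecProj (x γ) ⊗ₖ vecProj (y γ)) = l γ := by
  obtain ⟨F, hF⟩ := hli.exists_dotProduct_eq_ite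
  have hxx : star (x γ).ofLp ⬝ᵥ (x γ).ofLp = 1 := by
    rw [dotProduct_comm, ← EuclideanSpace.inner_eq_star_dotProduct, inner_self_eq_norm_sq_to_K, hx]
    simp
  have hval : ∀ δ, productForm (star (x γ).ofLp) (F γ) (vecProj (x δ) ⊗ₖ vecProj (y δ)) =
      if δ = γ then 1 else 0 := by
    intro δ
    rw [productForm_vecProj, hF]
    by_cases h : δ = γ
    · subst h; simp [hxx]
    · simp [h, Ne.symm h]
  have h1 := hw.productForm_eq (star (x γ).ofLp) (F γ)
  have h2 : productForm (star (x γ).ofLp) (F γ) T = l γ := by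
    rw [hT, map_sum]
    simp only [map_smul, hval]
    simp
  rw [h2, Finset.sum_eq_single (vecProj (x γ) ⊗ₖ vecProj (y γ)), hval, if_pos rfl, mul_one] at h1
  · exact h1.symm
  · intro P hP hne
    obtain ⟨δ, rfl⟩ := hw.exists_eq_of_mem_support hx hy hli hinj hT hP
    rw [hval, if_neg, mul_zero]
    rintro rfl
    exact hne rfl
  · intro h
    rw [Finsupp.notMem_support_iff.1 h, zero_mul]

theorem hasUniquePureProductDecomposition_of_linearIndependent (htr : T.trace = 1)
    (hl : ∀ γ, 0 ≤ l γ) (hx : ∀ γ, ‖x γ‖ = 1) (hy : ∀ γ, ‖y γ‖ = 1)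
    (hli : LinearIndependent ℂ y) (hinj : Function.Injective fun γ => vecProj (x γ))
    (hT : T = ∑ γ, l γ • (vecProj (x γ) ⊗ₖ vecProj (y γ))) :
    HasUniquePureProductDecomposition T := by
  classical
  have hw : IsPureProductDecomposition T
      (∑ γ, Finsupp.single (vecProj (x γ) ⊗ₖ vecProj (y γ)) (l γ)) := by
    refine isPureProductDecomposition_of_trace_eq_one htr (fun P hP => ?_)
      (Finset.sum_nonneg fun γ _ => Finsupp.single_nonneg.2 (hl γ)) (by simpa [map_sum] using hT)
    obtain ⟨γ, -, hγ⟩ := Finset.mem_biUnion.1 (Finsupp.support_finsetSum hP)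
    rw [Finset.mem_singleton.1 (Finsupp.support_single_subset hγ)]
    exact ⟨x γ, y γ, hx γ, hy γ, rfl⟩
  refine ⟨_, hw, fun w' hw' => Finsupp.ext fun P => ?_⟩
  generalize ∑ γ, Finsupp.single (vecProj (x γ) ⊗ₖ vecProj (y γ)) (l γ) = w at hw ⊢
  by_cases h : ∃ γ, P = vecProj (x γ) ⊗ₖ vecProj (y γ)
  · obtain ⟨γ, rfl⟩ := h
    rw [hw.apply_eq hx hy hli hinj hT, hw'.apply_eq hx hy hli hinj hT]
  · rw [Finsupp.notMem_support_iff.1 fun hP =>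
        h (hw.exists_eq_of_mem_support hx hy hli hinj hT hP),
      Finsupp.notMem_support_iff.1 fun hP =>
        h (hw'.exists_eq_of_mem_support hx hy hli hinj hT hP)]

end Decomposition

/-! ### Splitting rank-one terms off positive matrices -/

section PosSemidef

variable {n : ℕ} {A : Matrix (Fin n) (Fin n) ℂ}

theorem Matrix.PosSemidef.exists_eq_sum_vecProj (hA : A.PosSemidef) :
    ∃ (r : ℕ) (c : Fin r → EuclideanSpace ℂ (Fin n)), A = ∑ k, vecProj (c k) := by
  obtain ⟨r, c, hc⟩ := Matrix.posSemidef_iff_eq_sum_vecMulVec.1 hA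
  exact ⟨r, fun k => WithLp.toLp 2 (c k), hc⟩

theorem Matrix.PosSemidef.exists_eq_vecProj_add (hA : A.PosSemidef) (h0 : A ≠ 0) :
    ∃ (u : EuclideanSpace ℂ (Fin n)) (R : Matrix (Fin n) (Fin n) ℂ),
      u ≠ 0 ∧ R.PosSemidef ∧ A = vecProj u + R := by
  obtain ⟨r, c, rfl⟩ := hA.exists_eq_sum_vecProj
  obtain ⟨k, -, hk⟩ := Finset.exists_ne_zero_of_sum_ne_zero h0
  refine ⟨c k, ∑ j ∈ Finset.univ.erase k, vecProj (c j), ?_,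
    Matrix.posSemidef_sum _ fun j _ => posSemidef_vecProj _,
    (Finset.add_sum_erase _ _ (Finset.mem_univ k)).symm⟩
  intro h
  exact hk (by ext i j; simp [h, vecProj])

theorem Matrix.PosSemidef.exists_eq_vecProj_add_vecProj_add (hA : A.PosSemidef) (h0 : A ≠ 0)
    (h1 : A.rank ≠ 1) :
    ∃ (u v : EuclideanSpace ℂ (Fin n)) (R : Matrix (Fin n) (Fin n) ℂ),
      u ≠ 0 ∧ (∀ c : ℂ, v ≠ c • u) ∧ R.PosSemidef ∧ A = vecProj u + vecProj v + R := by
  obtain ⟨r, c, rfl⟩ := hA.exists_eq_sum_vecProj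
  obtain ⟨k, -, hk⟩ := Finset.exists_ne_zero_of_sum_ne_zero h0
  have hck : c k ≠ 0 := by
    intro h
    exact hk (by ext i j; simp [h, vecProj])
  obtain ⟨j, hj⟩ : ∃ j, ∀ a : ℂ, c j ≠ a • c k := by
    by_contra! hall
    choose a ha using hall
    -- If all `c j` were multiples of `c k`, the whole sum would be a single `z z^*`, of rank one.
    have hsum : ∑ j, vecProj (c j) =
        vecProj ((Real.sqrt (∑ j, Complex.normSq (a j)) : ℂ) • c k) := by
      rw [vecProj_smul, Complex.normSq_ofReal, Real.mul_self_sqrt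
        (Finset.sum_nonneg fun j _ => Complex.normSq_nonneg _), Finset.sum_smul]
      exact Finset.sum_congr rfl fun j _ => by rw [← vecProj_smul, ← ha]
    rw [hsum] at h0 h1
    refine h1 (rank_vecProj fun h => h0 ?_)
    rw [h]
    ext; simp [vecProj]
  have hjk : j ∈ Finset.univ.erase k :=
    Finset.mem_erase.2 ⟨fun h => hj 1 (by rw [h, one_smul]), Finset.mem_univ j⟩
  refine ⟨c k, c j, ∑ i ∈ (Finset.univ.erase k).erase j, vecProj (c i), hck, hj,
    Matrix.posSemidef_sum _ fun j _ => posSemidef_vecProj _, ?_⟩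
  rw [add_assoc, Finset.add_sum_erase _ (fun i => vecProj (c i)) hjk,
    Finset.add_sum_erase _ (fun i => vecProj (c i)) (Finset.mem_univ k)]

theorem Matrix.PosSemidef.exists_eq_smul_vecProj (hA : A.PosSemidef) (h1 : A.rank = 1) :
    ∃ u : EuclideanSpace ℂ (Fin n), ‖u‖ = 1 ∧ A = A.trace.re • vecProj u := by
  obtain ⟨⟨z, hz⟩, hz0, hspan⟩ := finrank_eq_one_iff'.1 h1
  have hz0 : z ≠ 0 := fun h => hz0 (Subtype.ext h)
  have hcol : ∀ j, ∃ d : ℂ, ∀ i, A i j = d * z i := by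
    intro j
    obtain ⟨d, hd⟩ := hspan ⟨A.mulVecLin (Pi.single j 1), ⟨_, rfl⟩⟩
    refine ⟨d, fun i => ?_⟩
    have := congrFun (congrArg Subtype.val hd) i
    simpa using this.symm
  choose d hd using hcol
  obtain ⟨k, hk⟩ := Function.ne_iff.1 hz0
  rw [Pi.zero_apply] at hk
  -- Every column is a multiple of `z`; hermiticity, compared along row `k` with `z k ≠ 0`, makes
  -- the factors proportional to `star (z j)`.
  have hdj : ∀ j, d j = star (z j) * (star (d k) / z k) := by
    intro j
    have := hA.1.apply k j
    rw [hd, hd, star_mul'] at this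
    rw [mul_div_assoc', eq_div_iff hk, ← this]
    ring
  set u : EuclideanSpace ℂ (Fin n) := WithLp.toLp 2 z
  have hu : ‖u‖ ≠ 0 := norm_ne_zero_iff.2 fun h => hz0 (congrArg WithLp.ofLp h)
  have hAu : A = (star (d k) / z k) • vecProj u := by
    ext i j
    rw [hd, hdj]
    simp only [vecProj, Matrix.smul_apply, Matrix.of_apply, smul_eq_mul, u]
    ring
  have hre : (A.trace.re : ℂ) = A.trace :=
    Complex.ext rfl (Complex.nonneg_iff.1 hA.trace_nonneg).2
  refine ⟨((‖u‖ : ℂ)⁻¹) • u, ?_, ?_⟩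
  · rw [norm_smul, norm_inv, Complex.norm_real, norm_norm, inv_mul_cancel₀ hu]
  · rw [vecProj_smul, ← Complex.coe_smul, hre, ← Complex.coe_smul, smul_smul, map_inv₀,
      Complex.normSq_ofReal]
    nth_rewrite 1 [hAu]
    congr 1
    have hu' : (‖u‖ : ℂ) ≠ 0 := Complex.ofReal_ne_zero.2 hu
    rw [hAu, Matrix.trace_smul, trace_vecProj, smul_eq_mul]
    push_cast
    field_simp

end PosSemidef

/-! ### Infinitely many ways to split `u u^* + v v^*` -/

section Arc

variable {n : ℕ} {u v : EuclideanSpace ℂ (Fin n)}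

/-- A curve of vectors in the real plane through `u` and `v`. -/
noncomputable def planeArc (u v : EuclideanSpace ℂ (Fin n)) (t : ℝ) : EuclideanSpace ℂ (Fin n) :=
  ((Real.sqrt (1 + t ^ 2))⁻¹ : ℂ) • (u + (t : ℂ) • v)

/-- The pair `(u + t v, t u - v)` divided by `√(1 + t²)` arises from `(u, v)` by a real orthogonal
matrix, which preserves `u u^* + v v^*`. -/
theorem exists_vecProj_planeArc_add (u v : EuclideanSpace ℂ (Fin n)) (t : ℝ) :
    ∃ z, vecProj u + vecProj v = vecProj (planeArc u v t) + vecProj z := by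
  refine ⟨((Real.sqrt (1 + t ^ 2))⁻¹ : ℂ) • ((t : ℂ) • u - v), ?_⟩
  have hs : Complex.normSq ((Real.sqrt (1 + t ^ 2))⁻¹ : ℂ) = (1 + t ^ 2)⁻¹ := by
    rw [map_inv₀, Complex.normSq_ofReal, Real.mul_self_sqrt (by positivity)]
  rw [planeArc, vecProj_smul, vecProj_smul, hs, ← smul_add, eq_inv_smul_iff₀ (by positivity)]
  ext i j
  simp [vecProj]
  ring

theorem eq_of_planeArc_eq_smul (hu : u ≠ 0) (hv : ∀ c : ℂ, v ≠ c • u) {t t' : ℝ} {c : ℂ}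
    (h : planeArc u v t = c • planeArc u v t') : t = t' := by
  have hpos : ∀ t : ℝ, ((Real.sqrt (1 + t ^ 2))⁻¹ : ℂ) ≠ 0 := fun t =>
    inv_ne_zero (Complex.ofReal_ne_zero.2 (by positivity))
  have hlin : ∀ a b : ℂ, a • u + b • v = 0 → a = 0 ∧ b = 0 := by
    intro a b hab
    have hb : b = 0 := by
      by_contra hb
      refine hv (-(b⁻¹ * a)) ?_
      rw [neg_smul, mul_smul, eq_neg_iff_add_eq_zero, ← inv_smul_smul₀ hb v, ← smul_add, add_comm,
        hab, smul_zero]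
    rw [hb, zero_smul, add_zero] at hab
    exact ⟨(smul_eq_zero.1 hab).resolve_right hu, hb⟩
  unfold planeArc at h
  set s : ℂ := ((Real.sqrt (1 + t ^ 2))⁻¹ : ℂ) with hs
  set s' : ℂ := ((Real.sqrt (1 + t' ^ 2))⁻¹ : ℂ)
  obtain ⟨h1, h2⟩ := hlin (s - c * s') (s * t - c * s' * t') (by
    rw [← sub_eq_zero] at h
    rw [← h]
    module)
  have h3 : s * (t - t') = 0 := by linear_combination h2 - t' * h1
  exact_mod_cast sub_eq_zero.1 ((mul_eq_zero.1 h3).resolve_left (hpos t))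

theorem planeArc_ne_zero (hu : u ≠ 0) (hv : ∀ c : ℂ, v ≠ c • u) (t : ℝ) : planeArc u v t ≠ 0 := by
  intro h
  -- The zero vector would be `0` times the vector at the different parameter `t + 1`.
  have := eq_of_planeArc_eq_smul hu hv (t := t) (t' := t + 1) (c := 0) (by rw [h, zero_smul])
  linarith

end Arc

/-! ### Unique decomposition forces rank one -/

section Separable

variable {m n : ℕ} {T R S : Matrix (Fin m × Fin n) (Fin m × Fin n) ℂ}

/-- A nonnegative combination of pure product states. -/
def IsSeparableMatrix (R : Matrix (Fin m × Fin n) (Fin m × Fin n) ℂ) : Prop :=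
  ∃ w : Matrix (Fin m × Fin n) (Fin m × Fin n) ℂ →₀ ℝ,
    (∀ P ∈ w.support, IsPureProductState P) ∧ 0 ≤ w ∧ R = Finsupp.linearCombination ℝ id w

theorem IsSeparableMatrix.zero : IsSeparableMatrix (0 : Matrix (Fin m × Fin n) (Fin m × Fin n) ℂ) :=
  ⟨0, by simp, le_rfl, by simp⟩

theorem IsSeparableMatrix.add (hR : IsSeparableMatrix R) (hS : IsSeparableMatrix S) :
    IsSeparableMatrix (R + S) := by
  classical
  obtain ⟨v, hv, hv0, rfl⟩ := hR
  obtain ⟨w, hw, hw0, rfl⟩ := hS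
  refine ⟨v + w, fun P hP => ?_, add_nonneg hv0 hw0, (map_add _ _ _).symm⟩
  exact (Finset.mem_union.1 (Finsupp.support_add hP)).elim (hv P) (hw P)

theorem IsSeparableMatrix.sum {ι : Type*} {s : Finset ι}
    {f : ι → Matrix (Fin m × Fin n) (Fin m × Fin n) ℂ} (h : ∀ i ∈ s, IsSeparableMatrix (f i)) :
    IsSeparableMatrix (∑ i ∈ s, f i) :=
  Finset.sum_induction f IsSeparableMatrix (fun _ _ => IsSeparableMatrix.add)
    IsSeparableMatrix.zero h

theorem exists_isPureProductState_smul {x : EuclideanSpace ℂ (Fin m)}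
    {y : EuclideanSpace ℂ (Fin n)} (hx : x ≠ 0) (hy : y ≠ 0) :
    ∃ P, IsPureProductState P ∧ ∃ r : ℝ, 0 < r ∧ vecProj x ⊗ₖ vecProj y = r • P := by
  have hx0 : ‖x‖ ≠ 0 := norm_ne_zero_iff.2 hx
  have hy0 : ‖y‖ ≠ 0 := norm_ne_zero_iff.2 hy
  refine ⟨_, ⟨((‖x‖ : ℂ)⁻¹) • x, ((‖y‖ : ℂ)⁻¹) • y, ?_, ?_, rfl⟩, ‖x‖ ^ 2 * ‖y‖ ^ 2,
    by positivity, ?_⟩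
  · rw [norm_smul, norm_inv, Complex.norm_real, norm_norm, inv_mul_cancel₀ hx0]
  · rw [norm_smul, norm_inv, Complex.norm_real, norm_norm, inv_mul_cancel₀ hy0]
  · rw [vecProj_smul, vecProj_smul, Matrix.smul_kronecker, Matrix.kronecker_smul, smul_smul,
      smul_smul, map_inv₀, map_inv₀, Complex.normSq_ofReal, Complex.normSq_ofReal]
    have : ‖x‖ ^ 2 * ‖y‖ ^ 2 * (‖x‖ * ‖x‖)⁻¹ * (‖y‖ * ‖y‖)⁻¹ = 1 := by field_simp
    rw [this, one_smul]

theorem isSeparableMatrix_vecProj_kronecker (x : EuclideanSpace ℂ (Fin m))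
    (y : EuclideanSpace ℂ (Fin n)) : IsSeparableMatrix (vecProj x ⊗ₖ vecProj y) := by
  by_cases h : x = 0 ∨ y = 0
  · have : vecProj x ⊗ₖ vecProj y = 0 := by
      ext i j
      rcases h with rfl | rfl <;> simp [vecProj]
    rw [this]
    exact IsSeparableMatrix.zero
  · obtain ⟨hx, hy⟩ := not_or.1 h
    obtain ⟨P, hP, r, hr, h⟩ := exists_isPureProductState_smul hx hy
    refine ⟨Finsupp.single P r, fun Q hQ => ?_, Finsupp.single_nonneg.2 hr.le, by simp [h]⟩
    rwa [Finset.mem_singleton.1 (Finsupp.support_single_subset hQ)]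

theorem Matrix.PosSemidef.isSeparableMatrix_kronecker {A : Matrix (Fin m) (Fin m) ℂ}
    {B : Matrix (Fin n) (Fin n) ℂ} (hA : A.PosSemidef) (hB : B.PosSemidef) :
    IsSeparableMatrix (A ⊗ₖ B) := by
  obtain ⟨r, c, rfl⟩ := hA.exists_eq_sum_vecProj
  obtain ⟨s, d, rfl⟩ := hB.exists_eq_sum_vecProj
  have : (∑ k, vecProj (c k)) ⊗ₖ (∑ k, vecProj (d k)) =
      ∑ k, ∑ j, vecProj (c k) ⊗ₖ vecProj (d j) := by
    ext i j
    simp [Matrix.sum_apply, Finset.sum_mul_sum]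
  rw [this]
  exact IsSeparableMatrix.sum fun _ _ => IsSeparableMatrix.sum fun _ _ =>
    isSeparableMatrix_vecProj_kronecker _ _

/-- Of infinitely many product vectors whose projections can be split off from `T`, two are
proportional if `T` decomposes uniquely. -/
theorem HasUniquePureProductDecomposition.exists_smul (hT : HasUniquePureProductDecomposition T)
    (htr : T.trace = 1) {ι : Type*} [Infinite ι] {x : ι → EuclideanSpace ℂ (Fin m)}
    {y : ι → EuclideanSpace ℂ (Fin n)} (hx : ∀ t, x t ≠ 0) (hy : ∀ t, y t ≠ 0)
    (h : ∀ t, ∃ R, IsSeparableMatrix R ∧ T = vecProj (x t) ⊗ₖ vecProj (y t) + R) :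
    ∃ s t, s ≠ t ∧ (∃ c : ℂ, x s = c • x t) ∧ ∃ c : ℂ, y s = c • y t := by
  classical
  obtain ⟨w, -, hw⟩ := hT
  -- Splitting off the product vector of index `t` gives a decomposition with positive weight on its
  -- state; by uniqueness it is `w`, so the state lies in the support of `w`.
  have key : ∀ t, ∃ P : w.support, ∃ r : ℝ, 0 < r ∧ vecProj (x t) ⊗ₖ vecProj (y t) = r • P.1 := by
    intro t
    obtain ⟨P, hP, r, hr, hPr⟩ := exists_isPureProductState_smul (hx t) (hy t)
    obtain ⟨R, ⟨v, hv, hv0, rfl⟩, hR⟩ := h t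
    have hdec : IsPureProductDecomposition T (Finsupp.single P r + v) := by
      refine isPureProductDecomposition_of_trace_eq_one htr (fun Q hQ => ?_)
        (add_nonneg (Finsupp.single_nonneg.2 hr.le) hv0) (by simp [hR, hPr])
      rcases Finset.mem_union.1 (Finsupp.support_add hQ) with hQ | hQ
      · rwa [Finset.mem_singleton.1 (Finsupp.support_single_subset hQ)]
      · exact hv Q hQ
    refine ⟨⟨P, ?_⟩, r, hr, hPr⟩
    rw [← hw _ hdec, Finsupp.mem_support_iff, Finsupp.add_apply, Finsupp.single_eq_same]
    have := hv0 P
    rw [Finsupp.coe_zero, Pi.zero_apply] at this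
    positivity
  choose P r hr hP using key
  -- Pigeonhole: infinitely many indices, finitely many states in the support.
  obtain ⟨s, t, hst, hPst⟩ := Finite.exists_ne_map_eq_of_infinite P
  refine ⟨s, t, hst, exists_smul_of_kronecker_eq_smul (hx s) (hy s) (r := (r s * (r t)⁻¹ : ℝ)) ?_⟩
  rw [Complex.coe_smul, hP s, hPst, hP t, smul_smul, mul_assoc, inv_mul_cancel₀ (hr t).ne', mul_one]

variable {A : Matrix (Fin m) (Fin m) ℂ} {B : Matrix (Fin n) (Fin n) ℂ}

/-- Otherwise `A` contains `P_u + P_v` with `u`, `v` independent. Every vector of the arc, tensored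
with a fixed `y` taken from `B`, can be split off `T`, although no two vectors of the arc are
proportional. -/
theorem HasUniquePureProductDecomposition.rank_left (hT : HasUniquePureProductDecomposition T)
    (htr : T.trace = 1) (hA : A.PosSemidef) (hB : B.PosSemidef) (hA0 : A ≠ 0) (hB0 : B ≠ 0)
    (hR : IsSeparableMatrix R) (h : T = A ⊗ₖ B + R) : A.rank = 1 := by
  by_contra h1
  obtain ⟨u, v, A', hu, hv, hA', rfl⟩ := hA.exists_eq_vecProj_add_vecProj_add hA0 h1
  obtain ⟨y, B', hy, hB', rfl⟩ := hB.exists_eq_vecProj_add hB0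
  obtain ⟨s, t, hst, ⟨c, hc⟩, -⟩ := hT.exists_smul htr (planeArc_ne_zero hu hv) (fun _ => hy)
    fun t => by
      obtain ⟨z, hz⟩ := exists_vecProj_planeArc_add u v t
      refine ⟨vecProj z ⊗ₖ vecProj y + A' ⊗ₖ vecProj y +
        (vecProj u + vecProj v + A') ⊗ₖ B' + R, ?_, ?_⟩
      · exact (((isSeparableMatrix_vecProj_kronecker _ _).add
          (hA'.isSeparableMatrix_kronecker (posSemidef_vecProj _))).add
          (hA.isSeparableMatrix_kronecker hB')).add hR
      · rw [h, Matrix.kronecker_add, hz]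
        simp only [Matrix.add_kronecker, add_assoc]
  exact hst (eq_of_planeArc_eq_smul hu hv hc)

theorem HasUniquePureProductDecomposition.rank_right (hT : HasUniquePureProductDecomposition T)
    (htr : T.trace = 1) (hA : A.PosSemidef) (hB : B.PosSemidef) (hA0 : A ≠ 0) (hB0 : B ≠ 0)
    (hR : IsSeparableMatrix R) (h : T = A ⊗ₖ B + R) : B.rank = 1 := by
  by_contra h1
  obtain ⟨u, v, B', hu, hv, hB', rfl⟩ := hB.exists_eq_vecProj_add_vecProj_add hB0 h1
  obtain ⟨x, A', hx, hA', rfl⟩ := hA.exists_eq_vecProj_add hA0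
  obtain ⟨s, t, hst, -, c, hc⟩ := hT.exists_smul htr (fun _ => hx) (planeArc_ne_zero hu hv)
    fun t => by
      obtain ⟨z, hz⟩ := exists_vecProj_planeArc_add u v t
      refine ⟨vecProj x ⊗ₖ vecProj z + vecProj x ⊗ₖ B' +
        A' ⊗ₖ (vecProj u + vecProj v + B') + R, ?_, ?_⟩
      · exact (((isSeparableMatrix_vecProj_kronecker _ _).add
          ((posSemidef_vecProj _).isSeparableMatrix_kronecker hB')).add
          (hA'.isSeparableMatrix_kronecker hB)).add hR
      · rw [h, Matrix.add_kronecker, hz]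
        simp only [Matrix.kronecker_add, add_assoc]
  exact hst (eq_of_planeArc_eq_smul hu hv hc)

end Separable

/-! ### Canonical decompositions with terms of rank one -/

section Main

variable {m n p : ℕ} {T : Matrix (Fin m × Fin n) (Fin m × Fin n) ℂ}
  {A : Fin p → Matrix (Fin m) (Fin m) ℂ} {B : Fin p → Matrix (Fin n) (Fin n) ℂ}

theorem IsCanonicalDecomposition.rank_eq_one (h : IsCanonicalDecomposition T A B)
    (htr : T.trace = 1) (hT : HasUniquePureProductDecomposition T) (γ : Fin p) :
    (A γ).rank = 1 ∧ (B γ).rank = 1 := by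
  have hA0 : A γ ≠ 0 := by
    intro h0
    simpa [h0] using h.trace_left γ
  have hR : IsSeparableMatrix (∑ δ ∈ Finset.univ.erase γ, A δ ⊗ₖ B δ) :=
    IsSeparableMatrix.sum fun δ _ =>
      (h.posSemidef_left δ).isSeparableMatrix_kronecker (h.posSemidef_right δ)
  have hsum : T = A γ ⊗ₖ B γ + ∑ δ ∈ Finset.univ.erase γ, A δ ⊗ₖ B δ :=
    h.sum_eq.trans (Finset.add_sum_erase _ (fun δ => A δ ⊗ₖ B δ) (Finset.mem_univ γ)).symm
  exact ⟨hT.rank_left htr (h.posSemidef_left γ) (h.posSemidef_right γ) hA0 (h.ne_zero_right γ) hR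
      hsum,
    hT.rank_right htr (h.posSemidef_left γ) (h.posSemidef_right γ) hA0 (h.ne_zero_right γ) hR hsum⟩

/-- The trace of `A γ` is one, so `A γ` is itself a projection and the weight is the trace of `B γ`.
Each `y γ` lies in the image of `B γ`, so independent images make the `y γ` linearly independent. -/
theorem IsCanonicalDecomposition.exists_eq_sum_vecProj (h : IsCanonicalDecomposition T A B)
    (htr : T.trace = 1) (hrank : ∀ γ, (A γ).rank = 1 ∧ (B γ).rank = 1) :
    ∃ (l : Fin p → ℝ) (x : Fin p → EuclideanSpace ℂ (Fin m))
      (y : Fin p → EuclideanSpace ℂ (Fin n)),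
      (∀ γ, 0 ≤ l γ) ∧ ∑ γ, l γ = 1 ∧ (∀ γ, ‖x γ‖ = 1) ∧ (∀ γ, ‖y γ‖ = 1) ∧
      LinearIndependent ℂ y ∧ Function.Injective (fun γ => vecProj (x γ)) ∧
      T = ∑ γ, (l γ : ℂ) • (vecProj (x γ) ⊗ₖ vecProj (y γ)) := by
  choose x hx hAx using fun γ => (h.posSemidef_left γ).exists_eq_smul_vecProj (hrank γ).1
  choose y hy hBy using fun γ => (h.posSemidef_right γ).exists_eq_smul_vecProj (hrank γ).2
  have hA : ∀ γ, A γ = vecProj (x γ) := fun γ => by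
    have := hAx γ
    rwa [h.trace_left, Complex.one_re, one_smul] at this
  have hl : ∀ γ, (B γ).trace.re ≠ 0 := fun γ h0 => h.ne_zero_right γ (by rw [hBy γ, h0, zero_smul])
  have hT : T = ∑ γ, ((B γ).trace.re : ℂ) • (vecProj (x γ) ⊗ₖ vecProj (y γ)) := by
    refine h.sum_eq.trans (Finset.sum_congr rfl fun γ _ => ?_)
    conv_lhs => rw [hBy γ, hA γ, Matrix.kronecker_smul, ← Complex.coe_smul]
  refine ⟨fun γ => (B γ).trace.re, x, y,
    fun γ => (Complex.nonneg_iff.1 (h.posSemidef_right γ).trace_nonneg).1, ?_, hx, hy, ?_, ?_, hT⟩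
  · have := congrArg Matrix.trace hT
    simp only [htr, Matrix.trace_sum, Matrix.trace_smul, Matrix.trace_kronecker, trace_vecProj, hx,
      hy, smul_eq_mul, one_pow, Complex.ofReal_one, mul_one] at this
    exact_mod_cast this.symm
  · have hmem : ∀ γ, (y γ).ofLp ∈ matrixImage (B γ) := by
      intro γ
      have hdot : star (y γ).ofLp ⬝ᵥ (y γ).ofLp = 1 := by
        rw [dotProduct_comm, ← EuclideanSpace.inner_eq_star_dotProduct, inner_self_eq_norm_sq_to_K,
          hy]
        simp
      refine ⟨((B γ).trace.re : ℂ)⁻¹ • (y γ).ofLp, ?_⟩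
      have hBv : (B γ).mulVec (y γ).ofLp = ((B γ).trace.re : ℂ) • (y γ).ofLp := by
        conv_lhs => rw [hBy γ]
        rw [← Complex.coe_smul, Matrix.smul_mulVec, vecProj_eq_vecMulVec, Matrix.vecMulVec_mulVec,
          hdot]
        simp
      rw [Matrix.mulVecLin_apply, Matrix.mulVec_smul, hBv,
        inv_smul_smul₀ (Complex.ofReal_ne_zero.2 (hl γ))]
    have hne : ∀ γ, (y γ).ofLp ≠ 0 := fun γ h0 => by
      have : y γ = 0 := by ext i; exact congrFun h0 i
      simpa [this] using hy γ
    have := h.independent_right.linearIndependent _ hmem hne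
    exact LinearIndependent.of_comp (WithLp.linearEquiv 2 ℂ (Fin n → ℂ)).toLinearMap this
  · intro γ δ hγδ
    exact h.distinct_left ((hA γ).trans (hγδ.trans (hA δ).symm))

end Main

theorem mainTheorem4 {m n : ℕ} (T : Matrix (Fin m × Fin n) (Fin m × Fin n) ℂ)
    (hT : IsDensityMatrix T) (hB : IsBIndependent T) :
    -- the canonical decomposition exists and is unique up to order, and uniqueness of the
    -- decomposition into pure product states is decided by the ranks of its terms
    (∃ (p : ℕ) (A : Fin p → Matrix (Fin m) (Fin m) ℂ) (B : Fin p → Matrix (Fin n) (Fin n) ℂ),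
      IsCanonicalDecomposition T A B ∧
      (∀ (q : ℕ) (A' : Fin q → Matrix (Fin m) (Fin m) ℂ)
        (B' : Fin q → Matrix (Fin n) (Fin n) ℂ), IsCanonicalDecomposition T A' B' →
          ∃ σ : Fin q ≃ Fin p, ∀ γ, A' γ = A (σ γ) ∧ B' γ = B (σ γ)) ∧
      (HasUniquePureProductDecomposition T ↔ ∀ γ, (A γ).rank = 1 ∧ (B γ).rank = 1)) ∧
    (HasUniquePureProductDecomposition T ↔
      ∃ (p : ℕ) (l : Fin p → ℝ) (x : Fin p → EuclideanSpace ℂ (Fin m))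
        (y : Fin p → EuclideanSpace ℂ (Fin n)),
        (∀ γ, 0 ≤ l γ) ∧ ∑ γ, l γ = 1 ∧
        (∀ γ, ‖x γ‖ = 1) ∧ (∀ γ, ‖y γ‖ = 1) ∧
        LinearIndependent ℂ y ∧
        Function.Injective (fun γ => vecProj (x γ)) ∧
        T = ∑ γ, (l γ : ℂ) • (vecProj (x γ) ⊗ₖ vecProj (y γ))) := by
  -- Both equivalences come from one cycle: rank-one terms give the form with independent `y γ`,
  -- that form gives uniqueness, and uniqueness gives rank-one terms.
  have unique_of : (∃ (p : ℕ) (l : Fin p → ℝ) (x : Fin p → EuclideanSpace ℂ (Fin m))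
      (y : Fin p → EuclideanSpace ℂ (Fin n)),
      (∀ γ, 0 ≤ l γ) ∧ ∑ γ, l γ = 1 ∧ (∀ γ, ‖x γ‖ = 1) ∧ (∀ γ, ‖y γ‖ = 1) ∧
      LinearIndependent ℂ y ∧ Function.Injective (fun γ => vecProj (x γ)) ∧
      T = ∑ γ, (l γ : ℂ) • (vecProj (x γ) ⊗ₖ vecProj (y γ))) →
      HasUniquePureProductDecomposition T := by
    rintro ⟨p, l, x, y, hl, -, hx, hy, hli, hinj, hsum⟩
    exact hasUniquePureProductDecomposition_of_linearIndependent hT.trace_eq_one hl hx hy hli hinj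
      hsum
  obtain ⟨p, A, B, h⟩ := hB.exists_isCanonicalDecomposition
  refine ⟨⟨p, A, B, h, fun q A' B' h' => h.exists_equiv h', h.rank_eq_one hT.trace_eq_one,
    fun hrank => unique_of ⟨p, h.exists_eq_sum_vecProj hT.trace_eq_one hrank⟩⟩, fun hu => ?_,
    unique_of⟩
  exact ⟨p, h.exists_eq_sum_vecProj hT.trace_eq_one (h.rank_eq_one hT.trace_eq_one hu)⟩
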